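/- For every $n\in\mathbb N$ let $Y_n=(y_{i,j})_{i,j=1}^n$ be a random matrix whose entries are independent standard normal variables (the underlying probability space is $\mathbb R^{n^2}$ with the standard Gaussian measure), and let $U_n$ be the matrix whose columns are obtained by applying the Gram–Schmidt orthonormalization procedure to the columns of $Y_n$, in their given order (almost surely these columns form a basis of $\mathbb R^n$). For $1\le i\le n$ and $m\le n$ let $F_i^m\in\mathbb R^m$ be the vector formed by the first $m$ coordinates of the $i$-th row of $Y_n-\sqrt n\,U_n$, and let $\|\cdot\|$ be the Euclidean norm. For $0<\alpha\le 1$ put $$\varphi(\alpha)=2-\frac43\,\frac{1-(1-\alpha)^{3/2}}{\alpha}.$$ Theorem. Fix $0<\alpha\le 1$ and, for each $n$, let $m=\lfloor\alpha n\rfloor$. Then there exist $\delta$ with $0<\delta<\frac12$ and a constant $C>0$, independent of $n$, such that $$\sup_{1\le i\le n}\|F_i^m\|\le\sqrt{\varphi(\alpha)\,m}+C\,m^{\delta}\qquad\text{and}\qquad \inf_{1\le i\le n}\|F_i^m\|\ge\sqrt{\varphi(\alpha)\,m}-C\,m^{\delta},$$ each with probability exponentially close to $1$ as $n\to\infty$.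 Here a sequence of events $E_n$ is said to hold with probability exponentially close to $1$ if there are constants $a,K>0$ and $n_0\in\mathbb N$ such that $\Pr(E_n)\ge 1-K e^{-n^{a}}$ for all $n>n_0$. -/

import Mathlib

open MeasureTheory ProbabilityTheory

namespace GaussianGramSchmidt

noncomputable section

/-- The standard Gaussian measure on the space `ℝ^(n²)` of real `n × n` matrices, where
`Y i j` is the entry in row `i` and column `j`: the entries are independent standard normal variables. -/
def gaussianMatrix (n : ℕ) : Measure (Fin n → Fin n → ℝ) :=
  Measure.pi fun _ : Fin n => Measure.pi fun _ : Fin n => gaussianReal 0 1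

/-- The `j`-th column of the matrix `Y`, as a vector of Euclidean space. -/
def column {n : ℕ} (Y : Fin n → Fin n → ℝ) (j : Fin n) : EuclideanSpace ℝ (Fin n) :=
  WithLp.toLp 2 fun i => Y i j

/-- The matrix whose columns are obtained by applying the Gram-Schmidt orthonormalization
procedure to the columns of `Y`, in their given order. -/
def orthonormalization {n : ℕ} (Y : Fin n → Fin n → ℝ) : Fin n → Fin n → ℝ :=
  fun i j => InnerProductSpace.gramSchmidtNormed ℝ (column Y) j i

/-- The vector formed by the first `m` coordinates of the `i`-th row of `Y - √n U`, where `U` is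
the Gram-Schmidt orthonormalization of `Y` by columns (for `m ≤ n`). Its norm is Euclidean. -/
def truncatedRow {n : ℕ} (m : ℕ) (Y : Fin n → Fin n → ℝ) (i : Fin n) :
    EuclideanSpace ℝ {j : Fin n // (j : ℕ) < m} :=
  WithLp.toLp 2 fun j => Y i j - √(n : ℝ) * orthonormalization Y i j

/-- The function `φ(α) = 2 - (4/3) (1 - (1 - α)^(3/2)) / α`. -/
def phi (α : ℝ) : ℝ := 2 - 4 / 3 * ((1 - (1 - α) ^ (3 / 2 : ℝ)) / α)

/-- A sequence of probabilities is exponentially close to `1`: there is `a > 0`, independent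
of `n`, such that `p n ≥ 1 - O(exp (-n^a))`. -/
def ExponentiallyCloseToOne (p : ℕ → ℝ) : Prop :=
  ∃ a : ℝ, 0 < a ∧ ∃ K : ℝ, 0 < K ∧ ∃ n₀ : ℕ, ∀ n : ℕ, n₀ < n →
    1 - K * Real.exp (-((n : ℝ) ^ a)) ≤ p n

end

end GaussianGramSchmidt

/-!
Let `y j` be the columns of `Y` and `u j` the orthonormalized vectors, so that `⟪u j, y j⟫` is the
norm `r j` of the `j`-th Gram-Schmidt vector. The squared norm of the `i`-th truncated row is
`∑ Y i j ^ 2 + F (e i)`, summed over `j < m`, where `F = crossForm` is the quadratic form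
`F e = ∑ ⟪u j, e⟫ ⟪n u j - 2 √n y j, e⟫` and `e i` is the `i`-th coordinate vector. The first
sum is concentrated at `m`.

For the form `F` the point is rotation invariance: rotating all columns rotates the `u j`, so the
law of `F e` is the same for all unit vectors `e` (`crossForm_tail_eq`), and `e i` may be replaced
by the direction of a Gaussian vector `g` independent of `Y` (`crossForm_tail_le`). For fixed `Y`,
a Hanson-Wright inequality (`quadraticForm_tail`) shows that `F g` is close to the trace
`∑ (n - 2 √n r j)` of the form, with an error of the order of its Hilbert-Schmidt norm. Since the
`u j` are orthonormal, that norm is at most `(∑ ‖n u j - 2 √n y j‖²) ^ (1 / 2)`, of order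
`n ^ (3 / 2)` (`sum_norm_sq_symmRankOne_le`), which is small compared with `n²`. So `F (e i)` is
close to the trace divided by `n`.

It remains to find `r j`. Given the previous columns, `r j ^ 2 = ‖y j‖² - ∑ ⟪u i, y j⟫²`, summed over
`i < j`, is a difference of sums of `n` and of `j` squares of standard normal variables, so `r j` is
close to `√(n - j)`. Comparing `∑ √(n - j)` with the integral of the square root gives
`‖row‖² = φ(α) m + O(n ^ (13 / 16))` for all rows, outside an event of probability
`O(exp (-n ^ (1 / 16)))`; dividing by `√(φ(α) m)`, where `φ(α) > 0`, gives the exponent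
`δ = 13 / 16 - 1 / 2 = 5 / 16`.

With `x = n ^ (1 / 16)` all powers of `n` that occur are integral powers of `x`; every tail bound is
used for deviations of `x ^ 2 = n ^ (1 / 8)` times the bound on the Hilbert-Schmidt norm.
-/

open MeasureTheory ProbabilityTheory

namespace GaussianGramSchmidt

/-! ### Concentration of Gaussian quadratic forms -/

section QuadraticForms

lemma integral_exp_mul_sq_gaussianReal {x : ℝ} (hx : x < 1 / 2) :
    ∫ z, Real.exp (x * z ^ 2) ∂(gaussianReal 0 1) = √(1 / (1 - 2 * x)) := by
  rw [integral_gaussianReal_eq_integral_smul one_ne_zero]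
  have h : ∀ z : ℝ, gaussianPDFReal 0 1 z • Real.exp (x * z ^ 2) =
      (√(2 * Real.pi))⁻¹ * Real.exp (-(1 / 2 - x) * z ^ 2) := by
    intro z
    simp only [gaussianPDFReal, smul_eq_mul, NNReal.coe_one, mul_one, sub_zero]
    rw [mul_assoc, ← Real.exp_add]
    congr 2
    ring
  simp_rw [h]
  rw [integral_const_mul, integral_gaussian, ← Real.sqrt_inv, ← Real.sqrt_mul (by positivity)]
  congr 1
  have : 1 - 2 * x ≠ 0 := by linarith
  have : 1 / 2 - x ≠ 0 := by linarith
  field_simp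

lemma integrable_exp_mul_sq_gaussianReal {x : ℝ} (hx : x < 1 / 2) :
    Integrable (fun z => Real.exp (x * z ^ 2)) (gaussianReal 0 1) := by
  refine Integrable.of_integral_ne_zero ?_
  rw [integral_exp_mul_sq_gaussianReal hx]
  have : 0 < 1 - 2 * x := by linarith
  positivity

/-- With `u = 2 x`, the inverse of `1 - u` is the square of the moment generating function at `x` of a
squared standard normal variable. -/
lemma one_le_exp_mul_one_sub {u : ℝ} (hu : |u| ≤ 1 / 2) :
    1 ≤ Real.exp (u + u ^ 2) * (1 - u) := by
  obtain ⟨h1, h2⟩ := abs_le.1 hu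
  rcases le_total u 0 with h | h
  · have h3 := Real.add_one_le_exp (u + u ^ 2)
    have h4 : 0 ≤ -u ^ 3 := by nlinarith [sq_nonneg u]
    nlinarith [mul_le_mul_of_nonneg_right h3 (by linarith : (0 : ℝ) ≤ 1 - u)]
  · have h3 := Real.quadratic_le_exp_of_nonneg (x := u + u ^ 2) (by positivity)
    have h4 : 0 ≤ 1 - u - u ^ 2 - u ^ 3 := by
      have : u ^ 2 ≤ 1 / 4 := by nlinarith
      have : u ^ 3 ≤ 1 / 8 := by nlinarith
      linarith
    nlinarith [mul_le_mul_of_nonneg_right h3 (by linarith : (0 : ℝ) ≤ 1 - u),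
      mul_nonneg (sq_nonneg u) h4]

/-- A centred squared standard normal variable is sub-exponential. -/
lemma integral_exp_mul_sq_sub_one_le {x : ℝ} (hx : |x| ≤ 1 / 4) :
    ∫ z, Real.exp (x * (z ^ 2 - 1)) ∂(gaussianReal 0 1) ≤ Real.exp (2 * x ^ 2) := by
  obtain ⟨h1, h2⟩ := abs_le.1 hx
  have h : ∀ z : ℝ, Real.exp (x * (z ^ 2 - 1)) = Real.exp (-x) * Real.exp (x * z ^ 2) := by
    intro z
    rw [← Real.exp_add]
    ring_nf
  simp_rw [h]
  rw [integral_const_mul, integral_exp_mul_sq_gaussianReal (by linarith)]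
  have h3 : √(1 / (1 - 2 * x)) ≤ Real.exp (x + 2 * x ^ 2) := by
    rw [Real.sqrt_le_left (by positivity), div_le_iff₀ (by linarith), ← Real.exp_nat_mul]
    have h4 := one_le_exp_mul_one_sub (u := 2 * x) (by rw [abs_le]; constructor <;> linarith)
    refine h4.trans (le_of_eq ?_)
    congr 2
    push_cast
    ring
  calc Real.exp (-x) * √(1 / (1 - 2 * x)) ≤ Real.exp (-x) * Real.exp (x + 2 * x ^ 2) := by gcongr
    _ = Real.exp (2 * x ^ 2) := by rw [← Real.exp_add]; ring_nf

lemma integrable_exp_mul_sq_sub_one {x : ℝ} (hx : |x| ≤ 1 / 4) :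
    Integrable (fun z => Real.exp (x * (z ^ 2 - 1))) (gaussianReal 0 1) := by
  obtain ⟨h1, h2⟩ := abs_le.1 hx
  have h : ∀ z : ℝ, Real.exp (x * (z ^ 2 - 1)) = Real.exp (-x) * Real.exp (x * z ^ 2) := by
    intro z
    rw [← Real.exp_add]
    ring_nf
  simp_rw [h]
  exact (integrable_exp_mul_sq_gaussianReal (by linarith)).const_mul _

/-- The Chernoff bound with parameter `1 / (4 H)`, the largest one for which
`integral_exp_mul_sq_sub_one_le` applies to every weight. It loses the Gaussian part of the tail,
but an exponential tail suffices. -/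
lemma weighted_sum_upper_tail {ι : Type*} [Fintype ι] (w : ι → ℝ) {H : ℝ} (hH : 0 < H)
    (hw : ∑ k, w k ^ 2 ≤ H ^ 2) (s : ℝ) :
    (Measure.pi fun _ : ι => gaussianReal 0 1).real
      {z | s * H ≤ ∑ k, w k * (z k ^ 2 - 1)} ≤ 3 / 2 * Real.exp (-s / 4) := by
  set μ := Measure.pi fun _ : ι => gaussianReal 0 1
  have hwk : ∀ k, |1 / (4 * H) * w k| ≤ 1 / 4 := by
    intro k
    have h1 : |w k| ≤ H := by
      refine abs_le_of_sq_le_sq ?_ hH.le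
      exact (Finset.single_le_sum (f := fun k => w k ^ 2)
        (fun i _ => sq_nonneg _) (Finset.mem_univ k)).trans hw
    rw [abs_mul, abs_of_pos (by positivity), div_mul_eq_mul_div, div_le_iff₀ (by positivity)]
    linarith
  have hprod : ∀ z : ι → ℝ, Real.exp (1 / (4 * H) * ∑ k, w k * (z k ^ 2 - 1)) =
      ∏ k, Real.exp (1 / (4 * H) * w k * (z k ^ 2 - 1)) := by
    intro z
    rw [← Real.exp_sum, Finset.mul_sum]
    simp_rw [mul_assoc]
  have hint : Integrable (fun z : ι → ℝ =>
      Real.exp (1 / (4 * H) * ∑ k, w k * (z k ^ 2 - 1))) μ := by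
    simp_rw [hprod]
    exact Integrable.fintype_prod
      (f := fun k z => Real.exp (1 / (4 * H) * w k * (z ^ 2 - 1)))
      fun k => integrable_exp_mul_sq_sub_one (hwk k)
  refine (measure_ge_le_exp_mul_mgf (s * H) (t := 1 / (4 * H)) (by positivity) hint).trans ?_
  have hmgf : mgf (fun z : ι → ℝ => ∑ k, w k * (z k ^ 2 - 1)) μ (1 / (4 * H)) ≤ 3 / 2 := by
    unfold mgf
    simp_rw [hprod]
    rw [integral_fintype_prod_eq_prod
      (f := fun k z => Real.exp (1 / (4 * H) * w k * (z ^ 2 - 1)))]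
    calc ∏ k, ∫ z, Real.exp (1 / (4 * H) * w k * (z ^ 2 - 1)) ∂(gaussianReal 0 1)
        ≤ ∏ k, Real.exp (2 * (1 / (4 * H) * w k) ^ 2) :=
          Finset.prod_le_prod (fun k _ => integral_nonneg fun z => (Real.exp_pos _).le)
            fun k _ => integral_exp_mul_sq_sub_one_le (hwk k)
      _ = Real.exp (1 / (8 * H ^ 2) * ∑ k, w k ^ 2) := by
          rw [← Real.exp_sum, Finset.mul_sum]
          congr 1
          refine Finset.sum_congr rfl fun k _ => ?_
          field_simp
          ring
      _ ≤ Real.exp (1 / 8) := by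
          gcongr
          calc 1 / (8 * H ^ 2) * ∑ k, w k ^ 2 ≤ 1 / (8 * H ^ 2) * H ^ 2 := by gcongr
            _ = 1 / 8 := by field_simp
      _ ≤ 3 / 2 := by
          have h := Real.add_one_le_exp (-(1 / 8) : ℝ)
          rw [Real.exp_neg] at h
          rw [← inv_inv (Real.exp (1 / 8))]
          exact (inv_anti₀ (by norm_num) h).trans (by norm_num)
  calc _ ≤ Real.exp (-(1 / (4 * H)) * (s * H)) * (3 / 2) := by gcongr
    _ = 3 / 2 * Real.exp (-s / 4) := by
        rw [mul_comm]
        congr 2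
        field_simp

lemma weighted_sum_tail {ι : Type*} [Fintype ι] (w : ι → ℝ) {H : ℝ} (hH : 0 < H)
    (hw : ∑ k, w k ^ 2 ≤ H ^ 2) (s : ℝ) :
    (Measure.pi fun _ : ι => gaussianReal 0 1).real
      {z | s * H ≤ |∑ k, w k * (z k ^ 2 - 1)|} ≤ 3 * Real.exp (-s / 4) := by
  have h1 := weighted_sum_upper_tail w hH hw s
  have h2 := weighted_sum_upper_tail (fun k => -w k) hH (by simpa using hw) s
  have h3 : {z : ι → ℝ | s * H ≤ |∑ k, w k * (z k ^ 2 - 1)|} ⊆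
      {z | s * H ≤ ∑ k, w k * (z k ^ 2 - 1)} ∪ {z | s * H ≤ ∑ k, -w k * (z k ^ 2 - 1)} := by
    intro z hz
    simpa only [Set.mem_union, Set.mem_ofPred_eq, neg_mul, Finset.sum_neg_distrib, ← le_abs]
      using hz
  calc _ ≤ _ := measureReal_mono h3
    _ ≤ _ := measureReal_union_le _ _
    _ ≤ _ := by linarith

variable {E : Type*} [NormedAddCommGroup E] [InnerProductSpace ℝ E]

/-- The sum `∑ ‖T b‖²` over an orthonormal basis (the squared Hilbert-Schmidt norm of `T`) does not
depend on the basis. -/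
lemma sum_norm_sq_apply_eq {ι κ : Type*} [Fintype ι] [Fintype κ] {T : E →ₗ[ℝ] E}
    (hT : T.IsSymmetric) (b : OrthonormalBasis ι ℝ E) (v : OrthonormalBasis κ ℝ E) :
    ∑ k, ‖T (v k)‖ ^ 2 = ∑ i, ‖T (b i)‖ ^ 2 := by
  simp_rw [← fun k => b.sum_sq_inner_right (T (v k)), ← fun i => v.sum_sq_inner_right (T (b i))]
  rw [Finset.sum_comm]
  refine Finset.sum_congr rfl fun i _ => Finset.sum_congr rfl fun k _ => ?_
  rw [← hT, real_inner_comm]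

variable [FiniteDimensional ℝ E] [MeasurableSpace E] [BorelSpace E]

/-- A Hanson-Wright type inequality: diagonalizing `T` turns the quadratic form into a weighted sum
of squares of independent standard normal variables, the weights being the eigenvalues. -/
theorem quadraticForm_tail {ι : Type*} [Fintype ι] {T : E →ₗ[ℝ] E} (hT : T.IsSymmetric)
    (b : OrthonormalBasis ι ℝ E) {H : ℝ} (hH : 0 < H) (hb : ∑ i, ‖T (b i)‖ ^ 2 ≤ H ^ 2) (s : ℝ) :
    (stdGaussian E).real {g | s * H ≤ |inner ℝ g (T g) - LinearMap.trace ℝ E T|} ≤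
      3 * Real.exp (-s / 4) := by
  set v := hT.eigenvectorBasis rfl with hv
  set w := hT.eigenvalues rfl with hw
  have hTv : ∀ k, T (v k) = w k • v k := fun k =>
    hT.apply_eigenvectorBasis rfl k
  have htr : LinearMap.trace ℝ E T = ∑ k, w k := by
    rw [LinearMap.trace_eq_sum_inner T v]
    refine Finset.sum_congr rfl fun k _ => ?_
    rw [hTv, inner_smul_right, real_inner_self_eq_norm_sq, v.norm_eq_one]
    ring
  have hwsq : ∑ k, w k ^ 2 ≤ H ^ 2 := by
    refine le_trans (le_of_eq ?_) hb
    rw [← sum_norm_sq_apply_eq hT b v]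
    refine Finset.sum_congr rfl fun k _ => ?_
    rw [hTv, norm_smul, v.norm_eq_one, mul_one, Real.norm_eq_abs, sq_abs]
  have hcont : Continuous T := T.continuous_of_finiteDimensional
  rw [stdGaussian_eq_map_pi_orthonormalBasis v, map_measureReal_apply (by fun_prop)]
  · refine le_trans (le_of_eq ?_) (weighted_sum_tail w hH hwsq s)
    congr 1
    ext z
    simp only [Set.preimage_ofPred_eq, Set.mem_ofPred_eq]
    have : inner ℝ (∑ i, z i • v i) (T (∑ i, z i • v i)) - LinearMap.trace ℝ E T =
        ∑ k, w k * (z k ^ 2 - 1) := by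
      rw [htr, map_sum]
      simp_rw [map_smul, hTv, smul_smul, mul_sub, mul_one, Finset.sum_sub_distrib]
      rw [v.orthonormal.inner_sum]
      congr 1
      refine Finset.sum_congr rfl fun k _ => ?_
      simp
      ring
    rw [this]
  · exact measurableSet_le measurable_const (by fun_prop)

end QuadraticForms

open InnerProductSpace

/-! ### Quadratic forms given by a finite family of vectors -/

section RankOne

variable {E : Type*} [NormedAddCommGroup E] [InnerProductSpace ℝ E] {ι κ : Type*}

/-- The operator `x ↦ ∑ j ∈ s, ⟪a j, x⟫ b j`. -/
noncomputable def sumRankOne (s : Finset ι) (a b : ι → E) : E →ₗ[ℝ] E :=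
  ∑ j ∈ s, (innerₗ E (a j)).smulRight (b j)

lemma sumRankOne_apply (s : Finset ι) (a b : ι → E) (x : E) :
    sumRankOne s a b x = ∑ j ∈ s, inner ℝ (a j) x • b j := by
  simp [sumRankOne]

lemma inner_sumRankOne_left (s : Finset ι) (a b : ι → E) (x y : E) :
    inner ℝ (sumRankOne s a b x) y = inner ℝ x (sumRankOne s b a y) := by
  simp only [sumRankOne_apply, sum_inner, inner_sum, inner_smul_left, inner_smul_right]
  refine Finset.sum_congr rfl fun j _ => ?_
  rw [real_inner_comm x (a j)]
  simp [mul_comm]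

lemma trace_sumRankOne [FiniteDimensional ℝ E] (s : Finset ι) (a b : ι → E) :
    LinearMap.trace ℝ E (sumRankOne s a b) = ∑ j ∈ s, inner ℝ (a j) (b j) := by
  set v := stdOrthonormalBasis ℝ E
  rw [LinearMap.trace_eq_sum_inner _ v]
  simp only [sumRankOne_apply, inner_sum, inner_smul_right]
  rw [Finset.sum_comm]
  refine Finset.sum_congr rfl fun j _ => ?_
  exact v.sum_inner_mul_inner _ _

lemma sum_norm_sq_sumRankOne [Fintype κ] (v : OrthonormalBasis κ ℝ E) (s : Finset ι)
    (a b : ι → E) :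
    ∑ k, ‖sumRankOne s a b (v k)‖ ^ 2 =
      ∑ j ∈ s, ∑ l ∈ s, inner ℝ (a j) (a l) * inner ℝ (b j) (b l) := by
  simp only [← real_inner_self_eq_norm_sq, sumRankOne_apply, sum_inner, inner_sum,
    inner_smul_left, inner_smul_right, Finset.mul_sum]
  rw [Finset.sum_comm]
  refine Finset.sum_congr rfl fun j _ => ?_
  rw [Finset.sum_comm]
  refine Finset.sum_congr rfl fun l _ => ?_
  rw [← v.sum_inner_mul_inner (a j), Finset.sum_mul]
  refine Finset.sum_congr rfl fun k _ => ?_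
  rw [real_inner_comm (a l) (v k), real_inner_comm (b j) (b l)]
  simp
  ring

lemma sum_norm_sq_sumRankOne_orthonormal [Fintype κ] (v : OrthonormalBasis κ ℝ E)
    (s : Finset ι) {u : ι → E} (hu : Orthonormal ℝ u) (z : ι → E) :
    ∑ k, ‖sumRankOne s u z (v k)‖ ^ 2 = ∑ j ∈ s, ‖z j‖ ^ 2 ∧
      ∑ k, ‖sumRankOne s z u (v k)‖ ^ 2 = ∑ j ∈ s, ‖z j‖ ^ 2 := by
  classical
  simp_rw [sum_norm_sq_sumRankOne, orthonormal_iff_ite.1 hu]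
  constructor <;> refine Finset.sum_congr rfl fun j hj => ?_ <;>
    simp [hj]

/-- The symmetric operator whose quadratic form is `x ↦ ∑ j ∈ s, ⟪u j, x⟫ ⟪z j, x⟫`. -/
noncomputable def symmRankOne (s : Finset ι) (u z : ι → E) : E →ₗ[ℝ] E :=
  (1 / 2 : ℝ) • (sumRankOne s u z + sumRankOne s z u)

lemma isSymmetric_symmRankOne (s : Finset ι) (u z : ι → E) :
    (symmRankOne s u z).IsSymmetric := by
  intro x y
  simp only [symmRankOne, LinearMap.smul_apply, LinearMap.add_apply, inner_smul_left,
    inner_smul_right, inner_add_left, inner_add_right, inner_sumRankOne_left]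
  simp [add_comm]

lemma inner_symmRankOne_self (s : Finset ι) (u z : ι → E) (x : E) :
    inner ℝ x (symmRankOne s u z x) = ∑ j ∈ s, inner ℝ (u j) x * inner ℝ (z j) x := by
  simp only [symmRankOne, LinearMap.smul_apply, LinearMap.add_apply, inner_smul_right,
    inner_add_right, ← inner_sumRankOne_left s u z]
  rw [real_inner_comm x (sumRankOne s u z x), ← two_mul, ← mul_assoc]
  simp only [sumRankOne_apply, inner_sum, inner_smul_right, real_inner_comm]
  norm_num

lemma trace_symmRankOne [FiniteDimensional ℝ E] (s : Finset ι) (u z : ι → E) :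
    LinearMap.trace ℝ E (symmRankOne s u z) = ∑ j ∈ s, inner ℝ (u j) (z j) := by
  simp only [symmRankOne, map_smul, map_add, trace_sumRankOne, smul_eq_mul,
    fun j => real_inner_comm (u j) (z j)]
  ring

lemma sum_norm_sq_symmRankOne_le [Fintype κ] (v : OrthonormalBasis κ ℝ E)
    (s : Finset ι) {u : ι → E} (hu : Orthonormal ℝ u) (z : ι → E) :
    ∑ k, ‖symmRankOne s u z (v k)‖ ^ 2 ≤ ∑ j ∈ s, ‖z j‖ ^ 2 := by
  obtain ⟨h1, h2⟩ := sum_norm_sq_sumRankOne_orthonormal v s hu z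
  have h : ∀ k, ‖symmRankOne s u z (v k)‖ ^ 2 ≤
      (‖sumRankOne s u z (v k)‖ ^ 2 + ‖sumRankOne s z u (v k)‖ ^ 2) / 2 := by
    intro k
    have h3 := norm_add_le (sumRankOne s u z (v k)) (sumRankOne s z u (v k))
    rw [symmRankOne, LinearMap.smul_apply, LinearMap.add_apply, norm_smul, mul_pow]
    have h4 := pow_le_pow_left₀ (norm_nonneg _) h3 2
    norm_num
    nlinarith [sq_nonneg (‖sumRankOne s u z (v k)‖ - ‖sumRankOne s z u (v k)‖)]
  refine (Finset.sum_le_sum fun k _ => h k).trans ?_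
  rw [← Finset.sum_div, Finset.sum_add_distrib, h1, h2]
  linarith

variable [FiniteDimensional ℝ E] [MeasurableSpace E] [BorelSpace E]

/-- Concentration of `∑ j ∈ s, ⟪u j, g⟫ ⟪z j, g⟫` around its mean. Only one of the two families
has to be orthonormal; the Hilbert-Schmidt norm is then controlled by the other one. -/
lemma orthonormal_form_tail (s : Finset ι) {u : ι → E} (hu : Orthonormal ℝ u) (z : ι → E)
    {H : ℝ} (hH : 0 < H) (hz : ∑ j ∈ s, ‖z j‖ ^ 2 ≤ H ^ 2) (t : ℝ) :
    (stdGaussian E).real {g | t * H ≤ |∑ j ∈ s, inner ℝ (u j) g * inner ℝ (z j) g -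
      ∑ j ∈ s, inner ℝ (u j) (z j)|} ≤ 3 * Real.exp (-t / 4) := by
  have h := quadraticForm_tail (isSymmetric_symmRankOne s u z) (stdOrthonormalBasis ℝ E) hH
    ((sum_norm_sq_symmRankOne_le _ s hu z).trans hz) t
  simpa only [inner_symmRankOne_self, trace_symmRankOne] using h

/-- Sums of squares of coordinates of a Gaussian vector along an orthonormal family. -/
lemma sum_sq_inner_tail (s : Finset ι) {u : ι → E} (hu : Orthonormal ℝ u)
    {H : ℝ} (hH : 0 < H) (hs : (s.card : ℝ) ≤ H ^ 2) (t : ℝ) :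
    (stdGaussian E).real {g | t * H ≤ |∑ j ∈ s, inner ℝ (u j) g ^ 2 - s.card|} ≤
      3 * Real.exp (-t / 4) := by
  have h := orthonormal_form_tail s hu u hH (by simpa [hu.norm_eq_one] using hs) t
  simpa [← sq, real_inner_self_eq_norm_sq, hu.norm_eq_one] using h

lemma norm_sq_tail {n : ℕ} (hn : Module.finrank ℝ E = n) {H : ℝ} (hH : 0 < H)
    (hs : (n : ℝ) ≤ H ^ 2) (t : ℝ) :
    (stdGaussian E).real {g | t * H ≤ |‖g‖ ^ 2 - n|} ≤ 3 * Real.exp (-t / 4) := by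
  subst hn
  have h := sum_sq_inner_tail Finset.univ (stdOrthonormalBasis ℝ E).orthonormal hH
    (by simpa using hs) t
  simpa [(stdOrthonormalBasis ℝ E).sum_sq_inner_right] using h

lemma stdGaussian_inner_eq_zero {v : E} (hv : v ≠ 0) :
    stdGaussian E {g | inner ℝ v g = 0} = 0 := by
  have h := IsGaussian.map_eq_gaussianReal (μ := stdGaussian E) (innerSL ℝ v)
  rw [variance_dual_stdGaussian, innerSL_apply_norm] at h
  have h2 : stdGaussian E {g | inner ℝ v g = 0} =
      ((stdGaussian E).map (innerSL ℝ v)) {0} := by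
    rw [Measure.map_apply (by fun_prop) (measurableSet_singleton 0)]
    rfl
  have : NullSingletonClass (gaussianReal (stdGaussian E)[innerSL ℝ v] (‖v‖ ^ 2).toNNReal) :=
    nullSingletonClass_gaussianReal (by simpa using hv)
  rw [h2, h, measure_singleton]

end RankOne

/-! ### The Gram-Schmidt procedure -/

section GramSchmidt

variable {E : Type*} [NormedAddCommGroup E] [InnerProductSpace ℝ E] {n : ℕ}

lemma gramSchmidt_linearIsometryEquiv (O : E ≃ₗᵢ[ℝ] E) (c : Fin n → E) (j : Fin n) :
    gramSchmidt ℝ (fun k => O (c k)) j = O (gramSchmidt ℝ c j) := by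
  induction j using WellFoundedLT.induction with
  | ind j ih =>
    simp only [gramSchmidt_def ℝ _ j, Submodule.starProjection_singleton, map_sub, map_sum,
      map_smul]
    congr 1
    refine Finset.sum_congr rfl fun i hi => ?_
    rw [ih i (Finset.mem_Iio.1 hi), O.inner_map_map, O.norm_map]

lemma gramSchmidtNormed_linearIsometryEquiv (O : E ≃ₗᵢ[ℝ] E) (c : Fin n → E) (j : Fin n) :
    gramSchmidtNormed ℝ (fun k => O (c k)) j = O (gramSchmidtNormed ℝ c j) := by
  simp only [gramSchmidtNormed, gramSchmidt_linearIsometryEquiv, O.norm_map, map_smul]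

lemma gramSchmidt_update_of_lt (c : Fin n → E) {i j : Fin n} (hij : i < j) (y : E) :
    gramSchmidt ℝ (Function.update c j y) i = gramSchmidt ℝ c i := by
  induction i using WellFoundedLT.induction with
  | ind i ih =>
    rw [gramSchmidt_def, gramSchmidt_def, Function.update_of_ne hij.ne]
    congr 1
    refine Finset.sum_congr rfl fun k hk => ?_
    rw [ih k (Finset.mem_Iio.1 hk) ((Finset.mem_Iio.1 hk).trans hij)]

lemma inner_gramSchmidt_self (c : Fin n → E) (j : Fin n) :
    inner ℝ (gramSchmidt ℝ c j) (c j) = ‖gramSchmidt ℝ c j‖ ^ 2 := by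
  rw [gramSchmidt_def'' ℝ c j, inner_add_right, real_inner_self_eq_norm_sq, inner_sum,
    Finset.sum_eq_zero, add_zero]
  intro i hi
  rw [inner_smul_right, gramSchmidt_orthogonal ℝ c (Finset.mem_Iio.1 hi).ne', mul_zero]

lemma inner_gramSchmidtNormed_self (c : Fin n → E) (j : Fin n) :
    inner ℝ (gramSchmidtNormed ℝ c j) (c j) = ‖gramSchmidt ℝ c j‖ := by
  simp only [gramSchmidtNormed, inner_smul_left, inner_gramSchmidt_self]
  rcases eq_or_ne ‖gramSchmidt ℝ c j‖ 0 with h | h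
  · simp [h]
  · simp
    field_simp

/-- Pythagoras; it needs no linear independence, as a vanishing Gram-Schmidt vector contributes a
zero summand. -/
lemma norm_gramSchmidt_sq (c : Fin n → E) (j : Fin n) :
    ‖gramSchmidt ℝ c j‖ ^ 2 =
      ‖c j‖ ^ 2 - ∑ i ∈ Finset.Iio j, inner ℝ (gramSchmidtNormed ℝ c i) (c j) ^ 2 := by
  have h : inner ℝ (c j) (c j) = inner ℝ (gramSchmidt ℝ c j) (c j) +
      ∑ i ∈ Finset.Iio j, inner ℝ (gramSchmidtNormed ℝ c i) (c j) ^ 2 := by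
    conv_lhs =>
      enter [2]
      rw [gramSchmidt_def'' ℝ c j]
    rw [inner_add_left, sum_inner]
    congr 1
    refine Finset.sum_congr rfl fun i _ => ?_
    simp only [gramSchmidtNormed, inner_smul_left]
    simp
    ring
  rw [inner_gramSchmidt_self, real_inner_self_eq_norm_sq] at h
  linarith

lemma orthonormal_gramSchmidtNormed {c : Fin n → E} (hc : ∀ j, gramSchmidt ℝ c j ≠ 0) :
    Orthonormal ℝ (gramSchmidtNormed ℝ c) := by
  constructor
  · intro j
    exact gramSchmidtNormed_unit_length' (by simpa [gramSchmidtNormed] using hc j)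
  · intro i j hij
    simp [gramSchmidtNormed, inner_smul_left, inner_smul_right, gramSchmidt_orthogonal ℝ c hij]

variable [FiniteDimensional ℝ E] [MeasurableSpace E] [BorelSpace E]

@[fun_prop]
lemma measurable_gramSchmidt (j : Fin n) : Measurable fun c : Fin n → E => gramSchmidt ℝ c j := by
  induction j using WellFoundedLT.induction with
  | ind j ih =>
    simp only [gramSchmidt_def ℝ _ j, Submodule.starProjection_singleton]
    refine (measurable_pi_apply j).sub (Finset.measurable_sum _ fun i hi => ?_)
    have := ih i (Finset.mem_Iio.1 hi)
    simp only [RCLike.ofReal_real_eq_id, id_eq]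
    fun_prop

@[fun_prop]
lemma measurable_gramSchmidtNormed (j : Fin n) :
    Measurable fun c : Fin n → E => gramSchmidtNormed ℝ c j := by
  simp only [gramSchmidtNormed, RCLike.ofReal_real_eq_id, id_eq]
  fun_prop

end GramSchmidt

/-! ### Product measures -/

section Measure

/-- Resampling one coordinate preserves a product of probability measures. -/
lemma measurePreserving_update {ι α : Type*} [Fintype ι] [DecidableEq ι] [MeasurableSpace α]
    (μ : Measure α) [IsProbabilityMeasure μ] (j : ι) :
    MeasurePreserving (fun p : (ι → α) × α => Function.update p.1 j p.2)
      ((Measure.pi fun _ => μ).prod μ) (Measure.pi fun _ => μ) := by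
  have hm : Measurable fun p : (ι → α) × α => Function.update p.1 j p.2 :=
    measurable_pi_iff.2 fun i => by
      rcases eq_or_ne i j with rfl | h
      · simpa using measurable_snd
      · simp only [Function.update_of_ne h]
        fun_prop
  refine ⟨hm, (Measure.pi_eq fun s hs => ?_).symm⟩
  rw [Measure.map_apply hm (MeasurableSet.univ_pi hs)]
  have : (fun p : (ι → α) × α => Function.update p.1 j p.2) ⁻¹' Set.univ.pi s =
      Set.univ.pi (Function.update s j Set.univ) ×ˢ s j := by
    ext p
    simp only [Set.mem_preimage, Set.mem_univ_pi, Set.mem_prod]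
    constructor
    · intro h
      refine ⟨fun i => ?_, by simpa using h j⟩
      rcases eq_or_ne i j with rfl | hi
      · simp
      · simpa [hi] using h i
    · rintro ⟨h1, h2⟩ i
      rcases eq_or_ne i j with rfl | hi
      · simpa using h2
      · simpa [hi] using h1 i
  rw [this, Measure.prod_prod, Measure.pi_pi, ← Finset.mul_prod_erase _ _ (Finset.mem_univ j),
    ← Finset.mul_prod_erase _ (fun i => μ (s i)) (Finset.mem_univ j), mul_comm]
  simp only [Function.update_self, measure_univ, one_mul]
  congr 1
  refine Finset.prod_congr rfl fun i hi => ?_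
  rw [Function.update_of_ne (Finset.ne_of_mem_erase hi)]

/-- A matrix with independent identically distributed entries may be sampled by columns. -/
lemma map_transpose_pi {ι κ α : Type*} [Fintype ι] [Fintype κ] [MeasurableSpace α]
    (μ : Measure α) [IsProbabilityMeasure μ] :
    (Measure.pi fun _ : ι => Measure.pi fun _ : κ => μ).map (fun Y j i => Y i j) =
      Measure.pi fun _ : κ => Measure.pi fun _ : ι => μ := by
  have hm : Measurable fun (Y : ι → κ → α) j i => Y i j := by fun_prop
  symm
  refine Measure.pi_eq_generateFrom
    (C := fun _ => Set.univ.pi '' Set.univ.pi fun _ => {s | MeasurableSet s})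
    (fun _ => generateFrom_pi) (fun _ => isPiSystem_pi) (fun _ =>
      ⟨fun _ => Set.univ, fun _ => ⟨fun _ => Set.univ, fun _ _ => MeasurableSet.univ, Set.pi_univ _⟩,
        by simp, Set.iUnion_const _⟩) ?_
  intro s hs
  choose t ht hts using hs
  simp only [Set.mem_univ_pi, Set.mem_ofPred_eq] at ht
  have : (fun (Y : ι → κ → α) j i => Y i j) ⁻¹' Set.univ.pi s =
      Set.univ.pi fun i => Set.univ.pi fun j => t j i := by
    ext Y
    simp only [← hts, Set.mem_preimage, Set.mem_univ_pi]
    exact forall_comm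
  rw [Measure.map_apply hm, this, Measure.pi_pi]
  · simp only [Measure.pi_pi, ← hts]
    exact Finset.prod_comm
  · exact MeasurableSet.univ_pi fun j => hts j ▸ MeasurableSet.univ_pi (ht j)

/-- A union bound conditionally on the first coordinate. -/
lemma prod_measureReal_le {α β : Type*} [MeasurableSpace α] [MeasurableSpace β] {μ : Measure α}
    {ν : Measure β} [IsProbabilityMeasure μ] [IsProbabilityMeasure ν] {S : Set (α × β)}
    (hS : MeasurableSet S) (A : Set α) {B : ℝ} (hB : 0 ≤ B)
    (h : ∀ᵐ a ∂μ, a ∈ A ∨ ν.real (Prod.mk a ⁻¹' S) ≤ B) :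
    (μ.prod ν).real S ≤ μ.real A + B := by
  have h1 : (μ.prod ν) S ≤ μ A + ENNReal.ofReal B := by
    rw [Measure.prod_apply hS]
    calc ∫⁻ a, ν (Prod.mk a ⁻¹' S) ∂μ
        ≤ ∫⁻ a, ((toMeasurable μ A).indicator 1 a + ENNReal.ofReal B) ∂μ := by
          refine lintegral_mono_ae (h.mono fun a ha => ?_)
          rcases ha with ha | ha
          · rw [Set.indicator_of_mem (subset_toMeasurable μ A ha)]
            exact prob_le_one.trans le_self_add
          · refine le_trans ?_ le_add_self
            rw [← ofReal_measureReal]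
            exact ENNReal.ofReal_le_ofReal ha
      _ = μ A + ENNReal.ofReal B := by
          rw [lintegral_add_right _ measurable_const,
            lintegral_indicator_one (measurableSet_toMeasurable μ A), measure_toMeasurable]
          simp
  have h2 := ENNReal.toReal_mono (by simp) h1
  rwa [ENNReal.toReal_add (by simp) (by simp), ENNReal.toReal_ofReal hB] at h2

end Measure

/-! ### Independent Gaussian columns -/

/-- The law of the family of columns of a standard Gaussian matrix. -/
noncomputable def gaussianColumns (n : ℕ) : Measure (Fin n → EuclideanSpace ℝ (Fin n)) :=
  Measure.pi fun _ => stdGaussian (EuclideanSpace ℝ (Fin n))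

instance (n : ℕ) : IsProbabilityMeasure (gaussianColumns n) := by
  unfold gaussianColumns
  infer_instance

instance (n : ℕ) : IsProbabilityMeasure (gaussianMatrix n) := by
  unfold gaussianMatrix
  infer_instance

lemma measurePreserving_column (n : ℕ) :
    MeasurePreserving (column (n := n)) (gaussianMatrix n) (gaussianColumns n) := by
  have h1 : MeasurePreserving (fun (Y : Fin n → Fin n → ℝ) j i => Y i j) (gaussianMatrix n)
      (Measure.pi fun _ : Fin n => Measure.pi fun _ : Fin n => gaussianReal 0 1) :=
    ⟨by fun_prop, map_transpose_pi _⟩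
  have h2 : MeasurePreserving (WithLp.toLp 2 : (Fin n → ℝ) → EuclideanSpace ℝ (Fin n))
      (Measure.pi fun _ : Fin n => gaussianReal 0 1) (stdGaussian _) :=
    ⟨by fun_prop, map_pi_eq_stdGaussian⟩
  exact (measurePreserving_pi _ _ fun _ => h2).comp h1

lemma measurePreserving_row {n : ℕ} (i : Fin n) :
    MeasurePreserving
      (fun Y : Fin n → Fin n → ℝ => (WithLp.toLp 2 (Y i) : EuclideanSpace ℝ (Fin n)))
      (gaussianMatrix n) (stdGaussian _) := by
  have h2 : MeasurePreserving (WithLp.toLp 2 : (Fin n → ℝ) → EuclideanSpace ℝ (Fin n))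
      (Measure.pi fun _ : Fin n => gaussianReal 0 1) (stdGaussian _) :=
    ⟨by fun_prop, map_pi_eq_stdGaussian⟩
  exact h2.comp (measurePreserving_eval _ i)

lemma measurePreserving_isometry_columns {n : ℕ}
    (O : EuclideanSpace ℝ (Fin n) ≃ₗᵢ[ℝ] EuclideanSpace ℝ (Fin n)) :
    MeasurePreserving (fun c : Fin n → EuclideanSpace ℝ (Fin n) => fun j => O (c j))
      (gaussianColumns n) (gaussianColumns n) :=
  measurePreserving_pi _ _ fun _ => ⟨by fun_prop, stdGaussian_map O⟩

section Columns

variable {n : ℕ}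

/-- A bound on the conditional probability of an event given all columns but the `j`-th one is a bound
on its probability. -/
lemma gaussianColumns_real_le_of_update (j : Fin n)
    {S : Set (Fin n → EuclideanSpace ℝ (Fin n))} (hS : MeasurableSet S) {B : ℝ} (hB : 0 ≤ B)
    (h : ∀ᵐ c ∂gaussianColumns n,
      (stdGaussian (EuclideanSpace ℝ (Fin n))).real {y | Function.update c j y ∈ S} ≤ B) :
    (gaussianColumns n).real S ≤ B := by
  have hp := measurePreserving_update (stdGaussian (EuclideanSpace ℝ (Fin n))) j
  have h1 := hp.measureReal_preimage hS.nullMeasurableSet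
  have h2 := prod_measureReal_le (hp.measurable hS) ∅ hB (h.mono fun c hc => Or.inr hc)
  rw [measureReal_empty, zero_add] at h2
  exact h1.symm.le.trans h2

/-- No Gram-Schmidt vector vanishes almost surely: the `j`-th column would have to be orthogonal to
any vector that is orthogonal to the previous ones. -/
lemma ae_gramSchmidt_ne_zero : ∀ᵐ c ∂gaussianColumns n, ∀ j, gramSchmidt ℝ c j ≠ 0 := by
  refine ae_all_iff.2 fun j => ?_
  have hS : MeasurableSet {c : Fin n → EuclideanSpace ℝ (Fin n) | gramSchmidt ℝ c j = 0} :=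
    measurable_gramSchmidt j (measurableSet_singleton 0)
  suffices (gaussianColumns n).real {c | gramSchmidt ℝ c j = 0} ≤ 0 by
    have h0 := le_antisymm this measureReal_nonneg
    rw [measureReal_eq_zero_iff] at h0
    simpa [ae_iff] using h0
  refine gaussianColumns_real_le_of_update j hS le_rfl (ae_of_all _ fun c => ?_)
  obtain ⟨v, hv, hv0⟩ : ∃ v ∈ (Submodule.span ℝ
      ((Finset.Iio j).image (gramSchmidt ℝ c) : Set (EuclideanSpace ℝ (Fin n))))ᗮ, v ≠ 0 := by
    refine Submodule.exists_mem_ne_zero_of_ne_bot fun h => ?_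
    rw [Submodule.orthogonal_eq_bot_iff] at h
    have h1 := finrank_span_finset_le_card (R := ℝ) ((Finset.Iio j).image (gramSchmidt ℝ c))
    rw [Set.finrank, h, finrank_top, finrank_euclideanSpace, Fintype.card_fin] at h1
    have h2 := h1.trans Finset.card_image_le
    rw [Fin.card_Iio] at h2
    omega
  have hsub : {y | Function.update c j y ∈
      {c : Fin n → EuclideanSpace ℝ (Fin n) | gramSchmidt ℝ c j = 0}} ⊆
      {y | inner ℝ v y = 0} := by
    intro y hy
    simp only [Set.mem_ofPred_eq] at hy ⊢
    have h1 := gramSchmidt_def'' ℝ (Function.update c j y) j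
    rw [hy, Function.update_self, zero_add] at h1
    rw [h1, inner_sum]
    refine Finset.sum_eq_zero fun i hi => ?_
    rw [gramSchmidt_update_of_lt c (Finset.mem_Iio.1 hi), inner_smul_right,
      (Submodule.mem_orthogonal' _ _).1 hv _ (Submodule.subset_span ?_), mul_zero]
    exact Finset.mem_coe.2 (Finset.mem_image_of_mem _ hi)
  have h0 : (stdGaussian (EuclideanSpace ℝ (Fin n))).real {y | inner ℝ v y = 0} = 0 := by
    rw [measureReal_eq_zero_iff]
    exact stdGaussian_inner_eq_zero hv0
  exact (measureReal_mono hsub).trans h0.le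

lemma norm_sq_column_tail (j : Fin n) {H : ℝ} (hH : 0 < H) (hs : (n : ℝ) ≤ H ^ 2) (t : ℝ) :
    (gaussianColumns n).real {c | t * H ≤ |‖c j‖ ^ 2 - n|} ≤ 3 * Real.exp (-t / 4) := by
  have h := norm_sq_tail (E := EuclideanSpace ℝ (Fin n)) (by simp) hH hs t
  rw [← (measurePreserving_eval (fun _ : Fin n => stdGaussian (EuclideanSpace ℝ (Fin n)))
    j).measureReal_preimage] at h
  · exact h
  · exact (measurableSet_le measurable_const (by fun_prop)).nullMeasurableSet

/-- Given the previous columns, the squared norm of the projection of the `j`-th column to their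
span is a sum of `j` squares of independent standard normal variables. -/
lemma sum_sq_inner_gramSchmidtNormed_tail (j : Fin n) {H : ℝ} (hH : 0 < H)
    (hs : (n : ℝ) ≤ H ^ 2) (t : ℝ) :
    (gaussianColumns n).real {c | t * H ≤
      |∑ i ∈ Finset.Iio j, inner ℝ (gramSchmidtNormed ℝ c i) (c j) ^ 2 - (j : ℕ)|} ≤
      3 * Real.exp (-t / 4) := by
  refine gaussianColumns_real_le_of_update j ?_ (by positivity) ?_
  · exact measurableSet_le measurable_const (by fun_prop)
  · filter_upwards [ae_gramSchmidt_ne_zero] with c hc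
    have hj : ((Finset.Iio j).card : ℝ) ≤ H ^ 2 := by
      rw [Fin.card_Iio]
      exact le_trans (by exact_mod_cast j.2.le) hs
    refine le_trans (le_of_eq ?_) (sum_sq_inner_tail (Finset.Iio j)
      (orthonormal_gramSchmidtNormed hc) hH hj t)
    congr 1
    ext y
    simp only [Set.mem_ofPred_eq, Fin.card_Iio, Function.update_self]
    rw [Finset.sum_congr rfl]
    intro i hi
    simp only [gramSchmidtNormed, gramSchmidt_update_of_lt c (Finset.mem_Iio.1 hi)]

/-! ### Rotation invariance -/

/-- The part of `∑ j ∈ s, ⟪y j - q u j, e⟫²` that involves the Gram-Schmidt vectors `u`, that is,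
`∑ j ∈ s, ⟪u j, e⟫ ⟪q² u j - 2 q y j, e⟫`, for a family `c` of columns `y`. -/
noncomputable def crossForm (q : ℝ) (s : Finset (Fin n)) (c : Fin n → EuclideanSpace ℝ (Fin n))
    (e : EuclideanSpace ℝ (Fin n)) : ℝ :=
  ∑ j ∈ s, inner ℝ (gramSchmidtNormed ℝ c j) e *
    inner ℝ (q ^ 2 • gramSchmidtNormed ℝ c j - (2 * q) • c j) e

lemma crossForm_isometry (q : ℝ) (s : Finset (Fin n)) (c : Fin n → EuclideanSpace ℝ (Fin n))
    (e : EuclideanSpace ℝ (Fin n))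
    (O : EuclideanSpace ℝ (Fin n) ≃ₗᵢ[ℝ] EuclideanSpace ℝ (Fin n)) :
    crossForm q s (fun j => O (c j)) (O e) = crossForm q s c e := by
  simp only [crossForm, gramSchmidtNormed_linearIsometryEquiv, ← map_smul, ← map_sub,
    O.inner_map_map]

lemma crossForm_smul (q : ℝ) (s : Finset (Fin n)) (c : Fin n → EuclideanSpace ℝ (Fin n))
    (r : ℝ) (e : EuclideanSpace ℝ (Fin n)) :
    crossForm q s c (r • e) = r ^ 2 * crossForm q s c e := by
  simp only [crossForm, inner_smul_right, Finset.mul_sum]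
  refine Finset.sum_congr rfl fun j _ => ?_
  ring

@[fun_prop]
lemma measurable_crossForm (q : ℝ) (s : Finset (Fin n)) :
    Measurable fun p : (Fin n → EuclideanSpace ℝ (Fin n)) × EuclideanSpace ℝ (Fin n) =>
      crossForm q s p.1 p.2 := by
  unfold crossForm
  fun_prop

lemma measurableSet_crossForm (q : ℝ) (s : Finset (Fin n)) (t L : ℝ)
    (e : EuclideanSpace ℝ (Fin n)) :
    MeasurableSet {c | t < |crossForm q s c e - L|} := by
  have h : Measurable fun c : Fin n → EuclideanSpace ℝ (Fin n) => crossForm q s c e := by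
    unfold crossForm
    fun_prop
  exact measurableSet_lt measurable_const (by fun_prop)

/-- Rotation invariance: the law of `crossForm` at a unit vector does not depend on that vector. -/
lemma crossForm_tail_eq (q : ℝ) (s : Finset (Fin n)) (t L : ℝ)
    {e e' : EuclideanSpace ℝ (Fin n)} (he : ‖e‖ = ‖e'‖) :
    (gaussianColumns n) {c | t < |crossForm q s c e - L|} =
      (gaussianColumns n) {c | t < |crossForm q s c e' - L|} := by
  set O := (Submodule.span ℝ {e - e'})ᗮ.reflection with hO
  have hOe : O e = e' := Submodule.reflection_sub he
  rw [← (measurePreserving_isometry_columns O).measure_preimage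
    (measurableSet_crossForm q s t L e').nullMeasurableSet]
  simp only [Set.preimage_ofPred_eq, ← hOe, crossForm_isometry]

/-- By rotation invariance a fixed unit vector may be replaced by an independent Gaussian
direction; concentration then only has to be checked for fixed columns. -/
lemma crossForm_tail_le (q : ℝ) (s : Finset (Fin n)) (t L : ℝ)
    {e : EuclideanSpace ℝ (Fin n)} (he : ‖e‖ = 1) (A : Set (Fin n → EuclideanSpace ℝ (Fin n)))
    {B : ℝ} (hB : 0 ≤ B)
    (h : ∀ c ∉ A, (stdGaussian (EuclideanSpace ℝ (Fin n))).real
      {g | t * ‖g‖ ^ 2 < |crossForm q s c g - L * ‖g‖ ^ 2|} ≤ B) :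
    (gaussianColumns n).real {c | t < |crossForm q s c e - L|} ≤ (gaussianColumns n).real A + B := by
  set S : Set ((Fin n → EuclideanSpace ℝ (Fin n)) × EuclideanSpace ℝ (Fin n)) :=
    {p | t * ‖p.2‖ ^ 2 < |crossForm q s p.1 p.2 - L * ‖p.2‖ ^ 2|} with hSdef
  have hS : MeasurableSet S := measurableSet_lt (by fun_prop) (by fun_prop)
  have hne : ∀ᵐ g ∂stdGaussian (EuclideanSpace ℝ (Fin n)), g ≠ 0 := by
    have h0 := stdGaussian_inner_eq_zero (v := e) (by rintro rfl; simp at he)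
    refine measure_mono_null ?_ h0
    intro g hg
    have : g = 0 := by simpa using hg
    simp [this]
  have hsec : ∀ᵐ g ∂stdGaussian (EuclideanSpace ℝ (Fin n)),
      (gaussianColumns n) ((fun c => (c, g)) ⁻¹' S) =
        (gaussianColumns n) {c | t < |crossForm q s c e - L|} := by
    filter_upwards [hne] with g hg
    have hg' : 0 < ‖g‖ := norm_pos_iff.2 hg
    rw [crossForm_tail_eq q s t L (e := e) (e' := ‖g‖⁻¹ • g)
      (by rw [he, norm_smul, norm_inv, norm_norm, inv_mul_cancel₀ hg'.ne'])]
    congr 1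
    ext c
    have h1 : crossForm q s c g = ‖g‖ ^ 2 * crossForm q s c (‖g‖⁻¹ • g) := by
      rw [← crossForm_smul, smul_smul, mul_inv_cancel₀ hg'.ne', one_smul]
    simp only [hSdef, Set.mem_preimage, Set.mem_ofPred_eq]
    rw [h1, mul_comm L, ← mul_sub, abs_mul, abs_of_pos (by positivity : (0 : ℝ) < ‖g‖ ^ 2),
      mul_comm t, mul_lt_mul_iff_right₀ (by positivity)]
  have hprod : ((gaussianColumns n).prod (stdGaussian (EuclideanSpace ℝ (Fin n)))) S =
      (gaussianColumns n) {c | t < |crossForm q s c e - L|} := by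
    rw [Measure.prod_apply_symm hS, lintegral_congr_ae hsec]
    simp
  have h2 := prod_measureReal_le (μ := gaussianColumns n)
    (ν := stdGaussian (EuclideanSpace ℝ (Fin n))) hS A hB
    (ae_of_all _ fun c => (em (c ∈ A)).imp_right fun hc => h c hc)
  rwa [measureReal_def, hprod] at h2

end Columns

/-! ### Concentration of the cross form -/

lemma abs_sub_sqrt_le {r a : ℝ} (hr : 0 ≤ r) (ha : 0 ≤ a) : (r - √a) ^ 2 ≤ |r ^ 2 - a| := by
  have h1 := Real.sq_sqrt ha
  have h2 := Real.sqrt_nonneg a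
  rcases le_total r (√a) with h | h
  · refine le_trans ?_ (neg_le_abs _)
    nlinarith
  · refine le_trans ?_ (le_abs_self _)
    nlinarith

section Columns

variable {n : ℕ}

/-- The typical value of `crossForm` at a unit vector, where `q = √n`. -/
noncomputable def crossMean (q : ℝ) (s : Finset (Fin n)) : ℝ :=
  ∑ j ∈ s, (1 - 2 * (√((n : ℝ) - (j : ℕ)) / q))

/-- Families of columns that are linearly dependent, or have an atypical norm or an atypical
projection to the span of the previous columns. -/
def atypicalColumns (n : ℕ) (h : ℝ) : Set (Fin n → EuclideanSpace ℝ (Fin n)) :=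
  {c | ¬ ∀ j, gramSchmidt ℝ c j ≠ 0} ∪ ((⋃ j, {c | h ≤ |‖c j‖ ^ 2 - n|}) ∪
    ⋃ j : Fin n, {c | h ≤
      |∑ i ∈ Finset.Iio j, inner ℝ (gramSchmidtNormed ℝ c i) (c j) ^ 2 - (j : ℕ)|})

lemma atypicalColumns_real_le {H : ℝ} (hH : 0 < H) (hs : (n : ℝ) ≤ H ^ 2) (t : ℝ) :
    (gaussianColumns n).real (atypicalColumns n (t * H)) ≤ 6 * n * Real.exp (-t / 4) := by
  have h0 : (gaussianColumns n).real {c | ¬ ∀ j, gramSchmidt ℝ c j ≠ 0} = 0 := by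
    rw [measureReal_eq_zero_iff]
    exact ae_gramSchmidt_ne_zero
  have h1 : (gaussianColumns n).real (⋃ j, {c | t * H ≤ |‖c j‖ ^ 2 - n|}) ≤
      ∑ _j : Fin n, 3 * Real.exp (-t / 4) :=
    (measureReal_iUnion_fintype_le _).trans
      (Finset.sum_le_sum fun j _ => norm_sq_column_tail j hH hs t)
  have h2 : (gaussianColumns n).real (⋃ j : Fin n, {c | t * H ≤
      |∑ i ∈ Finset.Iio j, inner ℝ (gramSchmidtNormed ℝ c i) (c j) ^ 2 - (j : ℕ)|}) ≤
      ∑ _j : Fin n, 3 * Real.exp (-t / 4) :=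
    (measureReal_iUnion_fintype_le _).trans
      (Finset.sum_le_sum fun j _ => sum_sq_inner_gramSchmidtNormed_tail j hH hs t)
  simp only [Finset.sum_const, Finset.card_univ, Fintype.card_fin, nsmul_eq_mul] at h1 h2
  unfold atypicalColumns
  refine (measureReal_union_le _ _).trans ?_
  rw [h0, zero_add]
  refine (measureReal_union_le _ _).trans ?_
  linarith

lemma sum_const_le_of_fin {a : ℝ} (ha : 0 ≤ a) (s : Finset (Fin n)) :
    ∑ _j ∈ s, a ≤ n * a := by
  rw [Finset.sum_const, nsmul_eq_mul]
  gcongr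
  exact_mod_cast (Finset.card_le_univ s).trans (Fintype.card_fin n).le

lemma abs_norm_gramSchmidt_sub_sqrt_le {c : Fin n → EuclideanSpace ℝ (Fin n)} {x : ℝ}
    (hx : 0 ≤ x) (hc : c ∉ atypicalColumns n (x ^ 10)) (j : Fin n) :
    |‖gramSchmidt ℝ c j‖ - √((n : ℝ) - (j : ℕ))| ≤ 2 * x ^ 5 := by
  simp only [atypicalColumns, Set.mem_union, Set.mem_iUnion, Set.mem_ofPred_eq, not_or,
    not_exists, not_le, not_not] at hc
  have hj : (0 : ℝ) ≤ (n : ℝ) - (j : ℕ) := by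
    rw [sub_nonneg]
    exact_mod_cast j.2.le
  have h1 := abs_sub_sqrt_le (norm_nonneg (gramSchmidt ℝ c j)) hj
  refine abs_le_of_sq_le_sq ?_ (by positivity)
  have h2 := abs_lt.1 (hc.2.1 j)
  have h3 := abs_lt.1 (hc.2.2 j)
  have h4 : |‖gramSchmidt ℝ c j‖ ^ 2 - ((n : ℝ) - (j : ℕ))| ≤ 2 * x ^ 10 := by
    rw [norm_gramSchmidt_sq, abs_le]
    constructor <;> linarith
  nlinarith [pow_nonneg hx 10]

lemma abs_crossMean_le {q : ℝ} (hq : 0 < q) (hqn : q ^ 2 = n) (s : Finset (Fin n)) :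
    |crossMean q s| ≤ n := by
  refine (Finset.abs_sum_le_sum_abs _ _).trans ((Finset.sum_le_sum fun j _ => ?_).trans
    ((sum_const_le_of_fin zero_le_one s).trans (mul_one _).le))
  have h1 : √((n : ℝ) - (j : ℕ)) ≤ q := by
    rw [Real.sqrt_le_left hq.le, hqn]
    simp
  have h2 : √((n : ℝ) - (j : ℕ)) / q ≤ 1 := (div_le_one hq).2 h1
  have h3 : 0 ≤ √((n : ℝ) - (j : ℕ)) / q := by positivity
  rw [abs_le]
  constructor <;> linarith

/-- The trace of the quadratic form `crossForm` at fixed columns. -/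
lemma abs_sum_inner_sub_crossMean_le {c : Fin n → EuclideanSpace ℝ (Fin n)} {x : ℝ}
    (hx : 0 < x) (hxn : x ^ 16 = n) (hc : c ∉ atypicalColumns n (x ^ 10)) (s : Finset (Fin n)) :
    |∑ j ∈ s, inner ℝ (gramSchmidtNormed ℝ c j)
      ((x ^ 8) ^ 2 • gramSchmidtNormed ℝ c j - (2 * x ^ 8) • c j) - crossMean (x ^ 8) s * n| ≤
      4 * x ^ 29 := by
  have hg : ∀ j, gramSchmidt ℝ c j ≠ 0 := by
    simp only [atypicalColumns, Set.mem_union, not_or, Set.mem_ofPred_eq, not_not] at hc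
    exact hc.1
  have hu := orthonormal_gramSchmidtNormed hg
  have h1 : ∀ j, inner ℝ (gramSchmidtNormed ℝ c j)
      ((x ^ 8) ^ 2 • gramSchmidtNormed ℝ c j - (2 * x ^ 8) • c j) -
      (1 - 2 * (√((n : ℝ) - (j : ℕ)) / x ^ 8)) * n =
      -(2 * x ^ 8) * (‖gramSchmidt ℝ c j‖ - √((n : ℝ) - (j : ℕ))) := by
    intro j
    rw [inner_sub_right, inner_smul_right, inner_smul_right, inner_gramSchmidtNormed_self,
      real_inner_self_eq_norm_sq, hu.norm_eq_one, ← hxn]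
    field_simp
    ring
  rw [crossMean, Finset.sum_mul, ← Finset.sum_sub_distrib]
  simp_rw [h1]
  calc _ ≤ ∑ _j ∈ s, 4 * x ^ 13 := by
        refine (Finset.abs_sum_le_sum_abs _ _).trans (Finset.sum_le_sum fun j _ => ?_)
        rw [abs_mul, abs_neg, abs_of_pos (by positivity : 0 < 2 * x ^ 8)]
        calc _ ≤ 2 * x ^ 8 * (2 * x ^ 5) := by
              gcongr
              exact abs_norm_gramSchmidt_sub_sqrt_le hx.le hc j
          _ = 4 * x ^ 13 := by ring
    _ ≤ n * (4 * x ^ 13) := sum_const_le_of_fin (by positivity) s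
    _ = 4 * x ^ 29 := by rw [← hxn]; ring

/-- The Hilbert-Schmidt norm of the quadratic form `crossForm` at fixed columns. -/
lemma sum_norm_sq_le {c : Fin n → EuclideanSpace ℝ (Fin n)} {x : ℝ}
    (hx : 1 ≤ x) (hxn : x ^ 16 = n) (hc : c ∉ atypicalColumns n (x ^ 10)) (s : Finset (Fin n)) :
    ∑ j ∈ s, ‖(x ^ 8) ^ 2 • gramSchmidtNormed ℝ c j - (2 * x ^ 8) • c j‖ ^ 2 ≤
      (5 * x ^ 24) ^ 2 := by
  simp only [atypicalColumns, Set.mem_union, Set.mem_iUnion, Set.mem_ofPred_eq, not_or,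
    not_exists, not_le, not_not] at hc
  have hu := orthonormal_gramSchmidtNormed hc.1
  calc _ ≤ ∑ _j ∈ s, 18 * x ^ 32 := by
        refine Finset.sum_le_sum fun j _ => ?_
        have h1 := norm_sub_le ((x ^ 8) ^ 2 • gramSchmidtNormed ℝ c j) ((2 * x ^ 8) • c j)
        rw [norm_smul, norm_smul, hu.norm_eq_one, mul_one, Real.norm_of_nonneg (by positivity),
          Real.norm_of_nonneg (by positivity)] at h1
        have h2 := (abs_lt.1 (hc.2.1 j)).2
        rw [← hxn] at h2
        have h3 : x ^ 10 ≤ x ^ 16 := pow_le_pow_right₀ hx (by norm_num)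
        have h4 : ‖c j‖ ^ 2 ≤ 2 * x ^ 16 := by linarith
        calc _ ≤ ((x ^ 8) ^ 2 + 2 * x ^ 8 * ‖c j‖) ^ 2 := by gcongr
          _ ≤ 2 * ((x ^ 8) ^ 2) ^ 2 + 2 * (2 * x ^ 8 * ‖c j‖) ^ 2 := by
              nlinarith [sq_nonneg ((x ^ 8) ^ 2 - 2 * x ^ 8 * ‖c j‖)]
          _ = 2 * x ^ 32 + 8 * x ^ 16 * ‖c j‖ ^ 2 := by ring
          _ ≤ 2 * x ^ 32 + 8 * x ^ 16 * (2 * x ^ 16) := by gcongr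
          _ = 18 * x ^ 32 := by ring
    _ ≤ n * (18 * x ^ 32) := sum_const_le_of_fin (by positivity) s
    _ = 18 * x ^ 48 := by rw [← hxn]; ring
    _ ≤ (5 * x ^ 24) ^ 2 := by nlinarith [pow_nonneg (zero_le_one.trans hx) 48]

/-- Concentration of `crossForm`, with `x = n ^ (1 / 16)`, so that `√n = x ^ 8`. -/
theorem crossForm_concentration {x : ℝ} (hx : 2 ≤ x) (hxn : x ^ 16 = n) (s : Finset (Fin n))
    {e : EuclideanSpace ℝ (Fin n)} (he : ‖e‖ = 1) :
    (gaussianColumns n).real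
      {c | 20 * x ^ 13 < |crossForm (x ^ 8) s c e - crossMean (x ^ 8) s|} ≤
      6 * (n + 1) * Real.exp (-x ^ 2 / 4) := by
  have hx1 : 1 ≤ x := by linarith
  have hx0 : 0 < x := by linarith
  have hH : (n : ℝ) ≤ (x ^ 8) ^ 2 := by rw [← hxn]; exact le_of_eq (by ring)
  have hA := atypicalColumns_real_le (pow_pos hx0 8) hH (x ^ 2)
  rw [show x ^ 2 * x ^ 8 = x ^ 10 by ring] at hA
  refine (crossForm_tail_le (x ^ 8) s (20 * x ^ 13) (crossMean (x ^ 8) s) he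
    (atypicalColumns n (x ^ 10)) (B := 6 * Real.exp (-x ^ 2 / 4)) (by positivity) ?_).trans
    (by linarith)
  intro c hc
  have hu : Orthonormal ℝ (gramSchmidtNormed ℝ c) := by
    refine orthonormal_gramSchmidtNormed ?_
    simp only [atypicalColumns, Set.mem_union, not_or, Set.mem_ofPred_eq, not_not] at hc
    exact hc.1
  have h1 := orthonormal_form_tail s hu _ (by positivity : 0 < 5 * x ^ 24)
    (sum_norm_sq_le hx1 hxn hc s) (x ^ 2)
  have h2 := norm_sq_tail (E := EuclideanSpace ℝ (Fin n)) (by simp) (pow_pos hx0 8) hH (x ^ 2)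
  refine (measureReal_mono (s₂ := {g | x ^ 2 * (5 * x ^ 24) ≤ |crossForm (x ^ 8) s c g -
    ∑ j ∈ s, inner ℝ (gramSchmidtNormed ℝ c j)
      ((x ^ 8) ^ 2 • gramSchmidtNormed ℝ c j - (2 * x ^ 8) • c j)|} ∪
    {g | x ^ 2 * x ^ 8 ≤ |‖g‖ ^ 2 - n|}) ?_).trans
    ((measureReal_union_le _ _).trans ((add_le_add h1 h2).trans (by linarith)))
  intro g hg
  by_contra hcon
  simp only [Set.mem_union, Set.mem_ofPred_eq, not_or, not_le] at hcon hg
  obtain ⟨h3, h4⟩ := hcon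
  have h5 := abs_sum_inner_sub_crossMean_le hx0 hxn hc s
  have h6 := abs_crossMean_le (pow_pos hx0 8) (by rw [← hxn]; ring) s
  set τ := ∑ j ∈ s, inner ℝ (gramSchmidtNormed ℝ c j)
      ((x ^ 8) ^ 2 • gramSchmidtNormed ℝ c j - (2 * x ^ 8) • c j)
  set L := crossMean (x ^ 8) s
  have h7 : |L * (n - ‖g‖ ^ 2)| ≤ x ^ 16 * (x ^ 2 * x ^ 8) := by
    rw [abs_mul, hxn, abs_sub_comm]
    exact mul_le_mul h6 h4.le (abs_nonneg _) (by positivity)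
  have h8 : |crossForm (x ^ 8) s c g - L * ‖g‖ ^ 2| ≤ 10 * x ^ 29 := by
    have h9 : crossForm (x ^ 8) s c g - L * ‖g‖ ^ 2 =
        (crossForm (x ^ 8) s c g - τ) + (τ - L * n) + L * (n - ‖g‖ ^ 2) := by ring
    have h10 : x ^ 26 ≤ x ^ 29 := pow_le_pow_right₀ hx1 (by norm_num)
    rw [h9]
    refine (abs_add_three _ _ _).trans ?_
    linarith [h3.le, h5, h7, h10, (by ring : x ^ 2 * (5 * x ^ 24) = 5 * x ^ 26),
      (by ring : x ^ 16 * (x ^ 2 * x ^ 8) = x ^ 26)]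
  -- The estimate `h8` is for `g`; dividing by `‖g‖²` needs `‖g‖² ≥ n / 2`.
  have h11 : x ^ 16 / 2 ≤ ‖g‖ ^ 2 := by
    have h12 := (abs_lt.1 h4).1
    rw [← hxn] at h12
    have h13 : 2 ≤ x ^ 6 := hx.trans (le_self_pow₀ hx1 (by norm_num))
    nlinarith [pow_pos hx0 10]
  have h14 : 20 * x ^ 13 * (x ^ 16 / 2) ≤ 20 * x ^ 13 * ‖g‖ ^ 2 := by gcongr
  linarith [(by ring : 20 * x ^ 13 * (x ^ 16 / 2) = 10 * x ^ 29)]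

end Columns

/-! ### Norms of the rows -/

section Rows

variable {n : ℕ}

/-- The indices of the first `m` columns. -/
def firstColumns (n m : ℕ) : Finset (Fin n) := Finset.univ.filter fun j => (j : ℕ) < m

lemma norm_truncatedRow_sq (m : ℕ) (Y : Fin n → Fin n → ℝ) (i : Fin n) :
    ‖truncatedRow m Y i‖ ^ 2 = ∑ j ∈ firstColumns n m, Y i j ^ 2 +
      crossForm √(n : ℝ) (firstColumns n m) (column Y)
        (EuclideanSpace.single i 1) := by
  rw [EuclideanSpace.norm_sq_eq, crossForm, ← Finset.sum_add_distrib]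
  have h : ∀ f : Fin n → ℝ, ∑ j : {j : Fin n // (j : ℕ) < m}, f j =
      ∑ j ∈ firstColumns n m, f j := fun f =>
    (Finset.sum_subtype _ (by simp [firstColumns]) f).symm
  simp only [truncatedRow, Real.norm_eq_abs, sq_abs]
  rw [h fun j => (Y i j - √(n : ℝ) * orthonormalization Y i j) ^ 2]
  refine Finset.sum_congr rfl fun j _ => ?_
  simp only [EuclideanSpace.inner_single_right, PiLp.sub_apply, PiLp.smul_apply, smul_eq_mul,
    orthonormalization, column, conj_trivial, one_mul]
  ring

lemma card_firstColumns {m : ℕ} (hm : m ≤ n) :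
    (firstColumns n m).card = m := by
  rw [firstColumns, Fin.card_filter_val_lt]
  exact min_eq_right hm

lemma sum_sq_row_tail {m : ℕ} (hm : m ≤ n) (i : Fin n) {H : ℝ} (hH : 0 < H)
    (hs : (n : ℝ) ≤ H ^ 2) (t : ℝ) :
    (gaussianMatrix n).real {Y | t * H ≤ |∑ j ∈ firstColumns n m, Y i j ^ 2 - m|} ≤
      3 * Real.exp (-t / 4) := by
  have h := sum_sq_inner_tail (firstColumns n m)
    (EuclideanSpace.basisFun (Fin n) ℝ).orthonormal hH
    (by rw [card_firstColumns hm]; exact le_trans (by exact_mod_cast hm) hs) t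
  simp only [EuclideanSpace.basisFun_inner, card_firstColumns hm] at h
  rw [← (measurePreserving_row i).measureReal_preimage] at h
  · exact h
  · exact (measurableSet_le measurable_const (by fun_prop)).nullMeasurableSet

/-- Simultaneous concentration of the squared norms of all truncated rows. -/
theorem norm_truncatedRow_sq_concentration {m : ℕ} (hm : m ≤ n) {x : ℝ} (hx : 2 ≤ x)
    (hxn : x ^ 16 = n) :
    (gaussianMatrix n).real {Y | ∃ i, 21 * x ^ 13 < |‖truncatedRow m Y i‖ ^ 2 -
      (m + crossMean √(n : ℝ) (firstColumns n m))|} ≤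
      n * ((6 * n + 9) * Real.exp (-x ^ 2 / 4)) := by
  have hx1 : 1 ≤ x := by linarith
  have hx0 : 0 < x := by linarith
  have hq : √(n : ℝ) = x ^ 8 := by
    rw [← hxn, show x ^ 16 = (x ^ 8) ^ 2 by ring, Real.sqrt_sq (by positivity)]
  rw [Set.ofPred_exists]
  refine (measureReal_iUnion_fintype_le _).trans ?_
  calc _ ≤ ∑ _i : Fin n, (6 * n + 9) * Real.exp (-x ^ 2 / 4) := Finset.sum_le_sum fun i _ => ?_
    _ = _ := by simp
  have h1 := sum_sq_row_tail hm i (pow_pos hx0 8)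
    (by rw [← hxn]; exact le_of_eq (by ring)) (x ^ 2)
  have h2 := crossForm_concentration hx hxn
    (firstColumns n m) (e := EuclideanSpace.single i 1) (by simp)
  rw [← (measurePreserving_column n).measureReal_preimage
    (measurableSet_crossForm _ _ _ _ _).nullMeasurableSet] at h2
  refine (measureReal_mono ?_).trans ((measureReal_union_le _ _).trans
    ((add_le_add h1 h2).trans (by linarith)))
  intro Y hY
  by_contra hcon
  simp only [Set.mem_union, Set.mem_ofPred_eq, Set.mem_preimage, not_or, not_le, not_lt]
    at hcon hY
  obtain ⟨h3, h4⟩ := hcon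
  rw [norm_truncatedRow_sq, hq] at hY
  have h5 : x ^ 2 * x ^ 8 ≤ x ^ 13 := by
    rw [← pow_add]
    exact pow_le_pow_right₀ hx1 (by norm_num)
  have h6 := (abs_add_le _ _).trans (add_le_add h3.le h4)
  rw [add_sub_add_comm] at hY
  linarith

end Rows

/-! ### The mean squared norm -/

lemma phi_eq {α : ℝ} (hα₁ : α ≤ 1) :
    phi α = 2 - 4 / 3 * ((1 - (1 - α) * √(1 - α)) / α) := by
  have h0 : 0 ≤ 1 - α := by linarith
  rw [phi, show (3 / 2 : ℝ) = 1 + 1 / 2 by norm_num, Real.rpow_add' h0 (by norm_num),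
    Real.rpow_one, ← Real.sqrt_eq_rpow]

lemma phi_pos {α : ℝ} (hα₀ : 0 < α) (hα₁ : α ≤ 1) : 0 < phi α := by
  rw [phi_eq hα₁]
  have h0 : 0 ≤ 1 - α := by linarith
  have h1 := Real.sq_sqrt h0
  have h2 := Real.sqrt_nonneg (1 - α)
  have h3 : √(1 - α) < 1 := by
    rw [Real.sqrt_lt' one_pos]
    linarith
  have h4 : (1 - (1 - α) * √(1 - α)) / α < 3 / 2 := by
    rw [div_lt_iff₀ hα₀]
    set b := √(1 - α)
    have h5 : α = 1 - b ^ 2 := by linarith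
    rw [h5]
    nlinarith [mul_pos (sub_pos.2 h3) (by linarith : 0 < 2 * b + 1),
      mul_pos (mul_pos (sub_pos.2 h3) (by linarith : 0 < 2 * b + 1)) (sub_pos.2 h3)]
  linarith

/-- An antiderivative of the square root on `[0, ∞)`. -/
noncomputable def sqrtIntegral (a : ℝ) : ℝ := 2 / 3 * (a * √a)

lemma sqrt_le_sqrtIntegral_sub {a : ℝ} (ha : 0 ≤ a) :
    √a ≤ sqrtIntegral (a + 1) - sqrtIntegral a ∧
      sqrtIntegral (a + 1) - sqrtIntegral a ≤ √(a + 1) := by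
  unfold sqrtIntegral
  have h1 := Real.sq_sqrt ha
  have h2 := Real.sq_sqrt (by linarith : 0 ≤ a + 1)
  have h3 := Real.sqrt_nonneg a
  have h4 : √a ≤ √(a + 1) := Real.sqrt_le_sqrt (by linarith)
  set p := √a
  set r := √(a + 1)
  have h5 : r ^ 2 - p ^ 2 = 1 := by linarith
  have h6 : a * p = p ^ 3 := by rw [← h1]; ring
  have h7 : (a + 1) * r = r ^ 3 := by rw [← h2]; ring
  rw [h6, h7]
  -- The identity `r² - p² = 1` is used to homogenize both inequalities.
  have h8 : p = p * (r ^ 2 - p ^ 2) := by rw [h5, mul_one]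
  have h9 : r = r * (r ^ 2 - p ^ 2) := by rw [h5, mul_one]
  have h10 : 0 ≤ (r - p) ^ 2 * (2 * r + p) := mul_nonneg (sq_nonneg _) (by linarith)
  have h11 : 0 ≤ (r - p) ^ 2 * (r + 2 * p) := mul_nonneg (sq_nonneg _) (by linarith)
  constructor <;> nlinarith

lemma sqrtIntegral_mono {a b : ℝ} (ha : 0 ≤ a) (hab : a ≤ b) :
    sqrtIntegral a ≤ sqrtIntegral b := by
  unfold sqrtIntegral
  have := Real.sqrt_le_sqrt hab
  have := ha.trans hab
  gcongr

lemma sum_sqrt_bounds {n m : ℕ} (hm : m ≤ n) :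
    sqrtIntegral n - sqrtIntegral (n - m) ≤ ∑ j ∈ Finset.range m, √((n : ℝ) - j) ∧
      ∑ j ∈ Finset.range m, √((n : ℝ) - j) ≤
        sqrtIntegral (n + 1) - sqrtIntegral (n - m + 1) := by
  induction m with
  | zero => simp
  | succ k ih =>
    obtain ⟨h1, h2⟩ := ih (by omega)
    have hk : (k : ℝ) + 1 ≤ n := by exact_mod_cast hm
    have h3 := (sqrt_le_sqrtIntegral_sub (a := (n : ℝ) - k) (by linarith)).1
    have h4 := (sqrt_le_sqrtIntegral_sub (a := (n : ℝ) - (k + 1)) (by linarith)).2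
    rw [show (n : ℝ) - (k + 1) + 1 = n - k by ring] at h4
    rw [Finset.sum_range_succ]
    push_cast
    rw [show (n : ℝ) - (k + 1) + 1 = n - k by ring]
    constructor <;> linarith

lemma abs_sum_sqrt_sub_le {n m : ℕ} {α : ℝ} (hα₁ : α ≤ 1) (hn : 1 ≤ n)
    (h1 : (m : ℝ) ≤ α * n) (h2 : α * n < m + 1) :
    |∑ j ∈ Finset.range m, √((n : ℝ) - j) / √n -
      2 / 3 * (n * (1 - (1 - α) * √(1 - α)))| ≤ 4 := by
  have hn' : (1 : ℝ) ≤ n := by exact_mod_cast hn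
  have hαn : α * n ≤ n := by nlinarith
  have hmn : m ≤ n := by exact_mod_cast h1.trans hαn
  have h0 : 0 ≤ 1 - α := by linarith
  obtain ⟨h3, h4⟩ := sum_sqrt_bounds hmn
  have hs : ∀ a : ℝ, a ≤ n → √(a + 1) ≤ 2 * √n := by
    intro a ha
    rw [Real.sqrt_le_left (by positivity), mul_pow, Real.sq_sqrt (by positivity)]
    linarith
  have h5 := (sqrt_le_sqrtIntegral_sub (a := (n : ℝ)) (by linarith)).2.trans (hs n le_rfl)
  have hb : 0 ≤ (n : ℝ) - α * n := by linarith
  have h6 := (sqrt_le_sqrtIntegral_sub hb).2.trans (hs _ (by linarith))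
  have h7 := sqrtIntegral_mono hb (by linarith : (n : ℝ) - α * n ≤ n - m)
  have h8 := sqrtIntegral_mono (by linarith : (0 : ℝ) ≤ n - m)
    (by linarith : (n : ℝ) - m ≤ n - α * n + 1)
  have h9 := sqrtIntegral_mono (by linarith : (0 : ℝ) ≤ n - m)
    (by linarith : (n : ℝ) - m ≤ n - m + 1)
  have hsn : 0 < √(n : ℝ) := by positivity
  have h10 : sqrtIntegral n - sqrtIntegral (n - α * n) =
      2 / 3 * (n * (1 - (1 - α) * √(1 - α))) * √n := by
    rw [sqrtIntegral, sqrtIntegral, show (n : ℝ) - α * n = (1 - α) * n by ring,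
      Real.sqrt_mul h0]
    ring
  rw [← Finset.sum_div]
  have h11 : |∑ j ∈ Finset.range m, √((n : ℝ) - j) -
      2 / 3 * (n * (1 - (1 - α) * √(1 - α))) * √n| ≤ 4 * √n := by
    rw [← h10, abs_le]
    constructor <;> linarith
  rw [← mul_le_mul_iff_of_pos_right hsn]
  refine le_trans (le_of_eq ?_) h11
  rw [← abs_of_pos hsn, ← abs_mul, abs_of_pos hsn, sub_mul, div_mul_cancel₀ _ hsn.ne']

lemma sum_firstColumns {n m : ℕ} (hm : m ≤ n) (f : ℕ → ℝ) :
    ∑ j ∈ firstColumns n m, f j = ∑ k ∈ Finset.range m, f k := by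
  have h : (firstColumns n m).map Fin.valEmbedding = Finset.range m := by
    ext k
    simp only [firstColumns, Finset.mem_map, Finset.mem_filter, Finset.mem_univ, true_and,
      Fin.valEmbedding_apply, Finset.mem_range]
    exact ⟨by rintro ⟨j, hj, rfl⟩; exact hj, fun hk => ⟨⟨k, hk.trans_le hm⟩, hk, rfl⟩⟩
  rw [← h, Finset.sum_map]
  rfl

lemma abs_mean_sub_phi_mul_le {n m : ℕ} {α : ℝ} (hα₀ : 0 < α) (hα₁ : α ≤ 1) (hn : 1 ≤ n)
    (h1 : (m : ℝ) ≤ α * n) (h2 : α * n < m + 1) :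
    |m + crossMean √(n : ℝ) (firstColumns n m) - phi α * m| ≤ 8 + 2 / α := by
  have hαn : α * n ≤ n := by nlinarith [(Nat.cast_nonneg n : (0 : ℝ) ≤ n)]
  have hmn : m ≤ n := by exact_mod_cast h1.trans hαn
  have h3 := abs_le.1 (abs_sum_sqrt_sub_le hα₁ hn h1 h2)
  have h4 : crossMean √(n : ℝ) (firstColumns n m) =
      m - 2 * ∑ j ∈ Finset.range m, √((n : ℝ) - j) / √n := by
    rw [crossMean, sum_firstColumns hmn fun k => 1 - 2 * (√((n : ℝ) - k) / √n),
      Finset.sum_sub_distrib, ← Finset.mul_sum]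
    simp
  rw [h4, phi_eq hα₁]
  set κ := 1 - (1 - α) * √(1 - α)
  have hκ : 0 ≤ κ ∧ κ ≤ 1 := by
    have h5 : √(1 - α) ≤ 1 := by
      rw [Real.sqrt_le_left zero_le_one]
      linarith
    have h6 : 0 ≤ √(1 - α) := Real.sqrt_nonneg _
    have h7 : 0 ≤ (1 - α) * √(1 - α) := mul_nonneg (by linarith) h6
    have h8 : (1 - α) * √(1 - α) ≤ 1 := by nlinarith
    exact ⟨by simp only [κ]; linarith, by simp only [κ]; linarith⟩
  set S := ∑ j ∈ Finset.range m, √((n : ℝ) - j) / √n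
  have h9 : (2 - 4 / 3 * (κ / α)) * m = 2 * m - 4 / 3 * (n * κ) + 4 / 3 * κ * ((α * n - m) / α) := by
    field_simp
    ring
  have h10 : 0 ≤ (α * n - m) / α := div_nonneg (by linarith) hα₀.le
  have h11 : (α * n - m) / α ≤ 1 / α := by gcongr; linarith
  have h12 : 0 ≤ 4 / 3 * κ * ((α * n - m) / α) :=
    mul_nonneg (mul_nonneg (by norm_num) hκ.1) h10
  have h13 : 4 / 3 * κ * ((α * n - m) / α) ≤ 2 / α := by
    calc _ ≤ 4 / 3 * 1 * (1 / α) := by gcongr; exact hκ.2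
      _ ≤ 2 / α := by
        rw [mul_one_div]
        gcongr
        norm_num
  have h14 : 0 < 2 / α := by positivity
  rw [h9, abs_le]
  constructor <;> linarith

/-! ### Conclusion -/

/-- The factor `x ^ 32 = n ^ 2` comes from the union bound over rows and columns. -/
lemma pow_mul_exp_neg_le (x : ℝ) :
    x ^ 32 * Real.exp (-x ^ 2 / 4) ≤ 8 ^ 16 * (Nat.factorial 16) * Real.exp 2 * Real.exp (-x) := by
  have h1 := Real.pow_div_factorial_le_exp (x ^ 2 / 8) (by positivity) 16
  rw [div_le_iff₀ (by positivity)] at h1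
  have h2 : x ^ 32 ≤ 8 ^ 16 * (Nat.factorial 16) * Real.exp (x ^ 2 / 8) := by
    calc x ^ 32 = 8 ^ 16 * (x ^ 2 / 8) ^ 16 := by ring
      _ ≤ 8 ^ 16 * (Real.exp (x ^ 2 / 8) * (Nat.factorial 16)) := by gcongr
      _ = _ := by ring
  calc x ^ 32 * Real.exp (-x ^ 2 / 4)
      ≤ 8 ^ 16 * (Nat.factorial 16) * Real.exp (x ^ 2 / 8) * Real.exp (-x ^ 2 / 4) := by gcongr
    _ = 8 ^ 16 * (Nat.factorial 16) * Real.exp (x ^ 2 / 8 + -x ^ 2 / 4) := by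
        rw [Real.exp_add]
        ring
    _ ≤ 8 ^ 16 * (Nat.factorial 16) * Real.exp (2 + -x) := by
        exact mul_le_mul_of_nonneg_left
          (Real.exp_le_exp.2 (by nlinarith [sq_nonneg (x - 4)])) (by positivity)
    _ = _ := by
        rw [Real.exp_add]
        ring

lemma abs_sub_sqrt_mul_sqrt_le {r b : ℝ} (hr : 0 ≤ r) (hb : 0 ≤ b) :
    |r - √b| * √b ≤ |r ^ 2 - b| := by
  have h1 := Real.sqrt_nonneg b
  conv_rhs => rw [← Real.sq_sqrt hb, sq_sub_sq, abs_mul, abs_of_nonneg (by positivity), mul_comm]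
  gcongr
  linarith

/-- No measurability is needed, by subadditivity of the outer measure. -/
lemma one_sub_le_measureReal {Ω : Type*} [MeasurableSpace Ω] {μ : Measure Ω}
    [IsProbabilityMeasure μ] {A E : Set Ω} (h : Aᶜ ⊆ E) : 1 - μ.real A ≤ μ.real E := by
  have h1 : μ.real Set.univ ≤ μ.real A + μ.real E :=
    (measureReal_mono (fun ω _ => (em (ω ∈ A)).imp_right fun hω => h hω)).trans
      (measureReal_union_le A E)
  rw [probReal_univ] at h1
  linarith

/-- All rows have norm close to `√(φ(α) m)`, with probability exponentially close to `1`. -/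
theorem exists_row_concentration {α : ℝ} (hα₀ : 0 < α) (hα₁ : α ≤ 1) :
    ∃ C : ℝ, 0 < C ∧ ∃ K : ℝ, 0 < K ∧ ∃ n₀ : ℕ, ∀ n : ℕ, n₀ < n →
      (gaussianMatrix n).real {Y | ∃ i, C * (⌊α * n⌋₊ : ℝ) ^ (5 / 16 : ℝ) <
        |‖truncatedRow ⌊α * n⌋₊ Y i‖ - √(phi α * ⌊α * n⌋₊)|} ≤
        K * Real.exp (-((n : ℝ) ^ (1 / 16 : ℝ))) := by
  have hφ := phi_pos hα₀ hα₁
  set D := 21 + (8 + 2 / α) with hD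
  have hD0 : 0 < D := by positivity
  refine ⟨D / √(phi α * (α / 2)) * (2 / α), by positivity,
    15 * (8 ^ 16 * (Nat.factorial 16) * Real.exp 2), by positivity,
    -- These thresholds give `n ^ (1 / 16) ≥ 2` and `⌊α n⌋ ≥ α n / 2`.
    max (2 ^ 16) ⌈2 / α⌉₊, fun n hn => ?_⟩
  obtain ⟨hn1, hn2⟩ := max_lt_iff.1 hn
  have hn1' : (2 : ℝ) ^ 16 ≤ n := by exact_mod_cast hn1.le
  have hn2' : 2 / α ≤ n := (Nat.le_ceil _).trans (by exact_mod_cast hn2.le)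
  have hn0 : (0 : ℝ) ≤ n := Nat.cast_nonneg n
  set x : ℝ := (n : ℝ) ^ (1 / 16 : ℝ) with hxdef
  have hxn : x ^ 16 = n := by
    rw [hxdef, ← Real.rpow_natCast, ← Real.rpow_mul hn0]
    norm_num
  have hx0 : 0 ≤ x := by positivity
  have hx : 2 ≤ x := by
    rw [← hxn] at hn1'
    exact le_of_pow_le_pow_left₀ (by norm_num) hx0 hn1'
  set m := ⌊α * n⌋₊ with hmdef
  have hm1 : (m : ℝ) ≤ α * n := Nat.floor_le (by positivity)
  have hm2 : α * n < m + 1 := Nat.lt_floor_add_one _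
  have hmn : m ≤ n := by
    have : (m : ℝ) ≤ n := hm1.trans (by nlinarith)
    exact_mod_cast this
  have hαn : 2 ≤ α * n := by rwa [div_le_iff₀' hα₀] at hn2'
  have hm3 : α / 2 * n ≤ m := by linarith
  have hmean := abs_mean_sub_phi_mul_le hα₀ hα₁ (by omega : 1 ≤ n) hm1 hm2
  have hx5 : x ^ 5 ≤ 2 / α * (m : ℝ) ^ (5 / 16 : ℝ) := by
    have h1 : x ^ 5 = (n : ℝ) ^ (5 / 16 : ℝ) := by
      rw [hxdef, ← Real.rpow_natCast, ← Real.rpow_mul hn0]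
      norm_num
    have h2 : (n : ℝ) ≤ 2 / α * m := by
      rw [div_mul_eq_mul_div, le_div_iff₀ hα₀]
      linarith
    have h3 : 1 ≤ 2 / α := by
      rw [le_div_iff₀ hα₀]
      linarith
    rw [h1]
    calc (n : ℝ) ^ (5 / 16 : ℝ) ≤ (2 / α * m) ^ (5 / 16 : ℝ) := by gcongr
      _ = (2 / α) ^ (5 / 16 : ℝ) * (m : ℝ) ^ (5 / 16 : ℝ) :=
          Real.mul_rpow (by positivity) (by positivity)
      _ ≤ 2 / α * (m : ℝ) ^ (5 / 16 : ℝ) := by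
          gcongr
          exact Real.rpow_le_self_of_one_le h3 (by norm_num)
  have hsqrt : √(phi α * (α / 2)) * x ^ 8 ≤ √(phi α * m) := by
    refine Real.le_sqrt_of_sq_le ?_
    rw [mul_pow, Real.sq_sqrt (by positivity), ← pow_mul, hxn, mul_assoc]
    gcongr
  have hkey := norm_truncatedRow_sq_concentration hmn hx hxn
  refine (measureReal_mono ?_).trans (hkey.trans ?_)
  · rintro Y ⟨i, hi⟩
    refine ⟨i, ?_⟩
    by_contra! hcon
    refine absurd hi (not_lt.2 ?_)
    have h1 : |‖truncatedRow m Y i‖ ^ 2 - phi α * m| ≤ D * x ^ 13 := by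
      have h2 := (abs_sub_le _ _ _).trans (add_le_add hcon hmean)
      have h3 : 1 ≤ x ^ 13 := one_le_pow₀ (by linarith)
      have h4 : 0 < 8 + 2 / α := by positivity
      nlinarith
    have h2 := (abs_sub_sqrt_mul_sqrt_le (norm_nonneg (truncatedRow m Y i))
      (by positivity : 0 ≤ phi α * m)).trans h1
    have hs0 : 0 < √(phi α * (α / 2)) := by positivity
    have hx8 : 0 < x ^ 8 := by positivity
    have h3 : |‖truncatedRow m Y i‖ - √(phi α * m)| * (√(phi α * (α / 2)) * x ^ 8) ≤
        D * x ^ 13 := le_trans (by gcongr) h2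
    calc |‖truncatedRow m Y i‖ - √(phi α * m)|
        ≤ D * x ^ 13 / (√(phi α * (α / 2)) * x ^ 8) := (le_div_iff₀ (by positivity)).2 h3
      _ = D / √(phi α * (α / 2)) * x ^ 5 := by field_simp
      _ ≤ D / √(phi α * (α / 2)) * (2 / α * (m : ℝ) ^ (5 / 16 : ℝ)) := by gcongr
      _ = _ := by ring
  · have hn3 : (1 : ℝ) ≤ n := by linarith
    calc (n : ℝ) * ((6 * n + 9) * Real.exp (-x ^ 2 / 4))
        ≤ n * (15 * n * Real.exp (-x ^ 2 / 4)) := by gcongr; linarith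
      _ = 15 * (x ^ 32 * Real.exp (-x ^ 2 / 4)) := by
          rw [← hxn]
          ring
      _ ≤ 15 * (8 ^ 16 * (Nat.factorial 16) * Real.exp 2 * Real.exp (-x)) :=
          mul_le_mul_of_nonneg_left (pow_mul_exp_neg_le x) (by norm_num)
      _ = _ := by ring

end GaussianGramSchmidt

theorem theorem1p1 (α : ℝ) (hα₀ : 0 < α) (hα₁ : α ≤ 1) :
    ∃ δ : ℝ, 0 < δ ∧ δ < 1 / 2 ∧ ∃ C : ℝ, 0 < C ∧
      GaussianGramSchmidt.ExponentiallyCloseToOne (fun n : ℕ =>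
        (GaussianGramSchmidt.gaussianMatrix n).real {Y |
          (⨆ i : Fin n, ‖GaussianGramSchmidt.truncatedRow ⌊α * n⌋₊ Y i‖) ≤
            √(GaussianGramSchmidt.phi α * ⌊α * n⌋₊) + C * (⌊α * n⌋₊ : ℝ) ^ δ}) ∧
      GaussianGramSchmidt.ExponentiallyCloseToOne (fun n : ℕ =>
        (GaussianGramSchmidt.gaussianMatrix n).real {Y |
          √(GaussianGramSchmidt.phi α * ⌊α * n⌋₊) - C * (⌊α * n⌋₊ : ℝ) ^ δ ≤
            (⨅ i : Fin n, ‖GaussianGramSchmidt.truncatedRow ⌊α * n⌋₊ Y i‖)}) := by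
  obtain ⟨C, hC, K, hK, n₀, h⟩ := GaussianGramSchmidt.exists_row_concentration hα₀ hα₁
  refine ⟨5 / 16, by norm_num, by norm_num, C, hC,
    ⟨1 / 16, by norm_num, K, hK, n₀, fun n hn => ?_⟩,
    ⟨1 / 16, by norm_num, K, hK, n₀, fun n hn => ?_⟩⟩ <;>
  · have : Nonempty (Fin n) := ⟨⟨0, by omega⟩⟩
    refine (sub_le_sub_left (h n hn) 1).trans
      (GaussianGramSchmidt.one_sub_le_measureReal fun Y hY => ?_)
    simp only [Set.mem_compl_iff, Set.mem_ofPred_eq, not_exists, not_lt, abs_le] at hY ⊢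
    first
    | exact ciSup_le fun i => by linarith [(hY i).2]
    | exact le_ciInf fun i => by linarith [(hY i).1]
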